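/- Let $X\in\mathbb R^{m\times n}$ and $r=\operatorname{rank}(X)$. Let $\mathcal P_W,\mathcal P_H\subset\mathbb R^r$ be convex polytopes (convex hulls of finitely many points), not necessarily full-dimensional. A *polytopic matrix factorization* (PMF) $(W,H,\mathcal P_W,\mathcal P_H)$ of $X$ of size $r$ consists of $W\in\mathbb R^{m\times r}$ and $H\in\mathbb R^{r\times n}$ with $X=WH$, all rows of $W$ in $\mathcal P_W$ and all columns of $H$ in $\mathcal P_H$. For a polytope $\mathcal P\subset\mathbb R^r$ let $L$ be the direction space of its affine hull. The maximum-volume inscribed ellipsoid (MVIE) $\mathcal E_{\mathcal P}$ of $\mathcal P$, with center $g$, is the ellipsoid of the affine hull of $\mathcal P$, that is, a set $\{x\in g+L : (x-g)^\top E(x-g)\le r\}$ with $E\in\mathbb R^{r\times r}$ positive definite, which is contained in $\mathcal P$ and has the largest $(\dim L)$-dimensional volume among all such ellipsoids contained in $\mathcal P$. For a set $\mathcal S$ put $\mathcal S^{*,g}=\{x\in L : \langle x,y-g\rangle\le 1 \text{ for all } y\in\mathcal S\}$. (If $\mathcal P$ is full-dimensional, then $L=\mathbb R^r$ and these are the usual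 ellipsoids, volume and polar.) Write $\operatorname{conv}(M)$ for the convex hull of the columns of a matrix $M$, $\operatorname{ext}$ for the set of extreme points and $\operatorname{bd}$ for the boundary (relative to the affine hull). A matrix $M$ with $r$ rows is a *sufficiently scattered factor* (SSF) corresponding to $\mathcal P$ if - [PMF.SSC1] $\mathcal E_{\mathcal P}\subseteq\operatorname{conv}(M)\subseteq\mathcal P$, and - [PMF.SSC2] $\operatorname{conv}(M)^{*,g}\cap\operatorname{bd}(\mathcal E_{\mathcal P}^{*,g})=\operatorname{ext}(\mathcal P^{*,g})$. A set $\mathcal X\subset\mathbb R^r$ is *permutation-and/or-sign-only invariant* (PSOI) if every $A\in\mathbb R^{r\times r}$ with $A(\mathcal X)=\mathcal X$ is a signed permutation $A=D\Pi$, where $\Pi$ is a permutation matrix and $D$ is a diagonal matrix with diagonal entries in $\{-1,1\}$. **Theorem.** Let $(W,H,\mathcal P_W,\mathcal P_H)$ be a PMF of $X$ of size $r=\operatorname{rank}(X)$. Suppose that $W^\top$ is an SSF corresponding to $\mathcal P_W$, that $H$ is an SSF corresponding to $\mathcal P_H$, and that $\operatorname{ext}(\mathcal P_W)$ and $\operatorname{ext}(\mathcal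 P_H)$ are PSOI sets. Then the PMF is identifiable: for every PMF $(W_*,H_*,\mathcal P_W,\mathcal P_H)$ of $X$ of size $r$ there are a permutation matrix $\Pi$ and a diagonal matrix $D$ with diagonal entries in $\{-1,1\}$ such that $W_*=W\Pi^\top D^{-1}$ and $H_*=D\Pi H$. -/

import Mathlib

open scoped Matrix MeasureTheory

namespace PMF2

noncomputable section

/-- The set of columns of an `r × n` matrix, as points of Euclidean space `ℝ^r`. -/
def columnSet {r n : ℕ} (H : Matrix (Fin r) (Fin n) ℝ) : Set (EuclideanSpace ℝ (Fin r)) :=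
  Set.range fun j : Fin n => WithLp.toLp 2 (H.col j)

/-- `conv(H)`: the convex hull of the columns of `H`. -/
def conv {r n : ℕ} (H : Matrix (Fin r) (Fin n) ℝ) : Set (EuclideanSpace ℝ (Fin r)) :=
  convexHull ℝ (columnSet H)

/-- A convex polytope: the convex hull of finitely many points. -/
def IsPolytope {r : ℕ} (P : Set (EuclideanSpace ℝ (Fin r))) : Prop :=
  ∃ V : Finset (EuclideanSpace ℝ (Fin r)), P = convexHull ℝ (V : Set (EuclideanSpace ℝ (Fin r)))

/-- `(W, H, PW, PH)` is a polytopic matrix factorization of `X`. -/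
structure IsPMF {m n r : ℕ} (X : Matrix (Fin m) (Fin n) ℝ)
    (W : Matrix (Fin m) (Fin r) ℝ) (H : Matrix (Fin r) (Fin n) ℝ)
    (PW PH : Set (EuclideanSpace ℝ (Fin r))) : Prop where
  polytope_left : IsPolytope PW
  polytope_right : IsPolytope PH
  eq_mul : X = W * H
  rows_mem : ∀ i, WithLp.toLp 2 (W.row i) ∈ PW
  cols_mem : ∀ j, WithLp.toLp 2 (H.col j) ∈ PH

/-- `A = D Π` with `Π` a permutation matrix and `D` a diagonal matrix with entries in `{-1, 1}`. -/
def IsSignedPermutation {r : ℕ} (A : Matrix (Fin r) (Fin r) ℝ) : Prop :=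
  ∃ (σ : Equiv.Perm (Fin r)) (d : Fin r → ℝ), (∀ i, d i = 1 ∨ d i = -1) ∧
    A = Matrix.diagonal d * σ.permMatrix ℝ

/-- Identifiability of the PMF `(W, H, PW, PH)` of `X`: every PMF `(W', H', PW, PH)` of `X` (with
the same inner size) is `W' = W Πᵀ D⁻¹`, `H' = D Π H` for a permutation matrix `Π` and a diagonal
matrix `D` with entries in `{-1, 1}`. -/
def IsIdentifiable {m n r : ℕ} (X : Matrix (Fin m) (Fin n) ℝ)
    (W : Matrix (Fin m) (Fin r) ℝ) (H : Matrix (Fin r) (Fin n) ℝ)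
    (PW PH : Set (EuclideanSpace ℝ (Fin r))) : Prop :=
  ∀ (W' : Matrix (Fin m) (Fin r) ℝ) (H' : Matrix (Fin r) (Fin n) ℝ), IsPMF X W' H' PW PH →
    ∃ (σ : Equiv.Perm (Fin r)) (d : Fin r → ℝ), (∀ i, d i = 1 ∨ d i = -1) ∧
      W' = W * (σ.permMatrix ℝ)ᵀ * (Matrix.diagonal d)⁻¹ ∧
      H' = Matrix.diagonal d * σ.permMatrix ℝ * H

/-- The ellipsoid with centre `g` and positive definite shape matrix `E` in the affine subspace
`g + L`. For `L = ⊤` this is `{x | (x - g)ᵀ E (x - g) ≤ r}`. -/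
def ellipsoid {r : ℕ} (L : Submodule ℝ (EuclideanSpace ℝ (Fin r)))
    (E : Matrix (Fin r) (Fin r) ℝ) (g : EuclideanSpace ℝ (Fin r)) :
    Set (EuclideanSpace ℝ (Fin r)) :=
  {x | x - g ∈ L ∧ (x - g).ofLp ⬝ᵥ (E *ᵥ (x - g).ofLp) ≤ (r : ℝ)}

/-- `S` is a maximum-volume inscribed ellipsoid of `P`, with centre `g`. Ellipsoids are those of the
affine hull of `P` and volume is the Euclidean volume of that affine hull, so that for a
full-dimensional `P` these are the usual ellipsoids of `ℝ^r` and the Lebesgue measure. -/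
structure IsMVIE {r : ℕ} (P S : Set (EuclideanSpace ℝ (Fin r)))
    (g : EuclideanSpace ℝ (Fin r)) : Prop where
  isEllipsoid : ∃ E : Matrix (Fin r) (Fin r) ℝ, E.PosDef ∧ S = ellipsoid (vectorSpan ℝ P) E g
  subset : S ⊆ P
  maximal : ∀ (E : Matrix (Fin r) (Fin r) ℝ) (c : EuclideanSpace ℝ (Fin r)), E.PosDef →
    ellipsoid (vectorSpan ℝ P) E c ⊆ P →
    μHE[Module.finrank ℝ (vectorSpan ℝ P)] (ellipsoid (vectorSpan ℝ P) E c) ≤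
      μHE[Module.finrank ℝ (vectorSpan ℝ P)] S

/-- The polar of `S` with respect to `g`, taken in the subspace `L`:
`{x ∈ L | ⟨x, y - g⟩ ≤ 1 for all y ∈ S}`. -/
def polarAt {r : ℕ} (L : Submodule ℝ (EuclideanSpace ℝ (Fin r)))
    (g : EuclideanSpace ℝ (Fin r)) (S : Set (EuclideanSpace ℝ (Fin r))) :
    Set (EuclideanSpace ℝ (Fin r)) :=
  {x | x ∈ L ∧ ∀ y ∈ S, inner ℝ x (y - g) ≤ 1}

/-- `H` is a sufficiently scattered factor corresponding to the polytope `P`, whose maximum-volume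
inscribed ellipsoid `S` has centre `g`:
`S ⊆ conv(H) ⊆ P` and `conv(H)^{*,g} ∩ bd(S^{*,g}) = ext(P^{*,g})`. Polars are taken in the
direction space of the affine hull of `P` and `bd` is the boundary relative to that space; both
restrictions are void if `P` is full-dimensional. -/
def IsSSF {r n : ℕ} (H : Matrix (Fin r) (Fin n) ℝ)
    (P : Set (EuclideanSpace ℝ (Fin r))) : Prop :=
  ∃ (S : Set (EuclideanSpace ℝ (Fin r))) (g : EuclideanSpace ℝ (Fin r)), IsMVIE P S g ∧
    (conv H ⊆ P ∧ S ⊆ conv H) ∧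
    polarAt (vectorSpan ℝ P) g (conv H) ∩ intrinsicFrontier ℝ (polarAt (vectorSpan ℝ P) g S) =
      (polarAt (vectorSpan ℝ P) g P).extremePoints ℝ

/-- Permutation-and/or-sign-only invariant sets: every linear map that maps `𝒳` onto itself is a
signed permutation. -/
def IsPSOI {r : ℕ} (𝒳 : Set (EuclideanSpace ℝ (Fin r))) : Prop :=
  ∀ A : Matrix (Fin r) (Fin r) ℝ, Matrix.toEuclideanLin A '' 𝒳 = 𝒳 → IsSignedPermutation A

end

end PMF2

/-! Since `r` is the rank of `X`, any second factorization has the form `H' = A H`, `W' = W G` with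
`A G = 1`. All columns of `A H` lie in `PH`, so `A` maps `conv H`, and with it the MVIE, into `PH`;
maximality of the volume forces `|det A| ≤ 1`. On the other side `Gᵀ` acts on `Wᵀ`, so `|det G| ≤ 1`
as well, and both determinants are `±1`.

The image of the MVIE of `PH` under `A` is then again an inscribed ellipsoid of maximal volume.
Uniqueness of the MVIE, proved by averaging two candidates, shows that `A` fixes its centre and maps
it onto itself (`IsMVIE.map_subset`). Dually, an adjoint `D` of `A` preserves the polar of the
ellipsoid and its boundary, and maps the polar of `PH` into that of `conv H`. By SSC2 it therefore
maps the finite set of extreme points of the polar of `PH` into itself, hence permutes it.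
Krein–Milman and the bipolar theorem turn this into `A(PH) = PH` (`IsSSF.map_columns`), so `A`
permutes `ext PH` and the PSOI condition applies.

Polytopes need not be full-dimensional: ellipsoids and polars live in the direction space `L` of the
affine hull, and determinants on `L` have to be compared with those on the whole space. -/

/-! ### Uniqueness of the maximum-volume ellipsoid, normalized to a unit ball -/

section MaximalBall

variable {V : Type*} [NormedAddCommGroup V] [InnerProductSpace ℝ V] [FiniteDimensional ℝ V]

/-- If every ellipsoid in a convex set has at most the volume of the unit ball, and the set contains
the unit ball and the image of the unit ball under an affine map of determinant `±1`, then the linear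
part of that map is an isometry. -/
theorem norm_map_eq_of_forall_abs_det_le_one {K : Set V} (hK : Convex ℝ K)
    (hball : ∀ u : V, ‖u‖ ≤ 1 → u ∈ K)
    (hmax : ∀ (M : V →ₗ[ℝ] V) (c : V), (∀ u, ‖u‖ ≤ 1 → c + M u ∈ K) → |LinearMap.det M| ≤ 1)
    (C : V →ₗ[ℝ] V) (a : V) (hC : ∀ u, ‖u‖ ≤ 1 → a + C u ∈ K) (hdet : |LinearMap.det C| = 1) :
    ∀ u, ‖C u‖ = ‖u‖ := by
  classical
  have hT : (C ∘ₗ LinearMap.adjoint C).IsPositive := by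
    simpa using LinearMap.isPositive_adjoint_comp_self (LinearMap.adjoint C)
  -- The left polar factor of `C` is `√T`, with eigenvalues `s i = √(μ i)`. It remains to show that
  -- they all equal 1.
  set T := C ∘ₗ LinearMap.adjoint C with hTdef
  have hdetT : LinearMap.det T = 1 := by
    have h := LinearMap.normDet_sq C
    rw [LinearMap.normDet_eq_abs_det, hdet] at h
    rw [hTdef, LinearMap.det_comp, mul_comm, ← LinearMap.det_comp]
    simpa using h.symm
  set b := hT.isSymmetric.eigenvectorBasis rfl with hb
  set μ := hT.isSymmetric.eigenvalues rfl with hμ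
  have hTb : ∀ i, T (b i) = μ i • b i := fun i =>
    hT.isSymmetric.apply_eigenvectorBasis rfl i
  have hprod : ∏ i, μ i = 1 := by
    have h := hT.isSymmetric.det_eq_prod_eigenvalues rfl
    rw [hdetT] at h
    simpa using h.symm
  have hμ0 : ∀ i, 0 < μ i := fun i =>
    lt_of_le_of_ne (hT.nonneg_eigenvalues rfl i) fun h => by
      rw [Finset.prod_eq_zero (Finset.mem_univ i) h.symm] at hprod
      exact zero_ne_one hprod
  let diag : (Fin (Module.finrank ℝ V) → ℝ) → V →ₗ[ℝ] V := fun d =>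
    Matrix.toLin b.toBasis b.toBasis (Matrix.diagonal d)
  have hdiag : ∀ d i, diag d (b i) = d i • b i := fun d i => by
    have h := Matrix.toLin_self b.toBasis b.toBasis (Matrix.diagonal d) i
    simp only [OrthonormalBasis.coe_toBasis] at h
    rw [show diag d (b i) = _ from h, Finset.sum_eq_single i]
    · simp
    · intro j _ hj; simp [Matrix.diagonal_apply_ne _ hj]
    · simp
  have hdiagT : diag μ = T := b.toBasis.ext fun i => by simp [hdiag, hTb]
  have hcomp : ∀ d e x, diag d (diag e x) = diag (d * e) x := fun d e x => by
    rw [← LinearMap.comp_apply]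
    congr 1
    refine b.toBasis.ext fun i => ?_
    simp [hdiag, smul_smul, mul_comm]
  have hone : ∀ x, diag 1 x = x := fun x => by
    simp [diag]
  set s : Fin (Module.finrank ℝ V) → ℝ := fun i => √(μ i) with hs
  have hs0 : ∀ i, 0 < s i := fun i => Real.sqrt_pos.2 (hμ0 i)
  have hss : s * s = μ := funext fun i => Real.mul_self_sqrt (hμ0 i).le
  have hsinv : s * s⁻¹ = 1 := funext fun i => mul_inv_cancel₀ (hs0 i).ne'
  have hsymm : ∀ x y, inner ℝ (diag s x) y = inner ℝ x (diag s y) := by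
    have hadj : LinearMap.adjoint (diag s) = diag s := by
      refine b.toBasis.ext fun i => ?_
      refine InnerProductSpace.ext_inner_right_basis b.toBasis fun j => ?_
      simp only [OrthonormalBasis.coe_toBasis, LinearMap.adjoint_inner_left, hdiag,
        inner_smul_left, inner_smul_right, OrthonormalBasis.inner_eq_ite]
      by_cases h : i = j <;> simp [h]
    intro x y
    rw [← LinearMap.adjoint_inner_left, hadj]
  have hs1 : ∀ i, s i = 1 := by
    have h2 : ∏ i, (1 + s i) / 2 ≤ 1 := by
      have h := hmax (diag fun i => (1 + s i) / 2) ((1 / 2 : ℝ) • a) fun u hu => by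
        -- This vector has the norm of `u`, and `C` sends it to `diag s u`. Hence `a + diag s u`
        -- lies in `K`, and so does its midpoint with `u`.
        have hw : ‖LinearMap.adjoint C (diag s⁻¹ u)‖ ≤ 1 := by
          have h3 : ‖LinearMap.adjoint C (diag s⁻¹ u)‖ ^ 2 = ‖u‖ ^ 2 := by
            rw [← real_inner_self_eq_norm_sq, ← real_inner_self_eq_norm_sq,
              LinearMap.adjoint_inner_left, ← LinearMap.comp_apply, ← hTdef, ← hdiagT, ← hss,
              ← hcomp, ← hsymm, hcomp, hsinv, hone]
          nlinarith [norm_nonneg u, norm_nonneg (LinearMap.adjoint C (diag s⁻¹ u))]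
        have h4 := hC _ hw
        rw [← LinearMap.comp_apply, ← hTdef, ← hdiagT, ← hss, ← hcomp, hcomp s s⁻¹, hsinv, hone]
          at h4
        have h5 : diag (fun i => (1 + s i) / 2) = (1 / 2 : ℝ) • (LinearMap.id + diag s) := by
          refine b.toBasis.ext fun i => ?_
          simp only [OrthonormalBasis.coe_toBasis, hdiag, LinearMap.smul_apply,
            LinearMap.add_apply, LinearMap.id_apply]
          module
        have h6 := hK (hball u hu) h4 (show (0 : ℝ) ≤ 1 / 2 by norm_num)
          (show (0 : ℝ) ≤ 1 / 2 by norm_num) (by norm_num)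
        convert h6 using 1
        rw [h5]
        simp only [LinearMap.smul_apply, LinearMap.add_apply, LinearMap.id_apply]
        module
      rw [LinearMap.det_toLin, Matrix.det_diagonal, abs_of_nonneg] at h
      · exact h
      · exact Finset.prod_nonneg fun i _ => by have := hs0 i; positivity
    -- AM–GM, `√s ≤ (1 + s) / 2`, is strict unless `s = 1`; against the bound `h2`, this product
    -- leaves no room for strictness.
    have h3 : ∏ i, √(s i) = 1 := by
      have h4 : (∏ i, √(s i)) ^ 4 = 1 := by
        rw [← Finset.prod_pow, ← hprod]
        refine Finset.prod_congr rfl fun i _ => ?_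
        rw [← hss, show 4 = 2 * 2 from rfl, pow_mul, Real.sq_sqrt (hs0 i).le]
        simp [sq]
      exact (pow_eq_one_iff_of_nonneg (Finset.prod_nonneg fun i _ => Real.sqrt_nonneg _)
        (by norm_num)).1 h4
    by_contra! hne
    obtain ⟨i, hi⟩ := hne
    have hle : ∀ j, √(s j) ≤ (1 + s j) / 2 := fun j => by
      nlinarith [sq_nonneg (√(s j) - 1), Real.sq_sqrt (hs0 j).le]
    have hlt : √(s i) < (1 + s i) / 2 := by
      have h5 : √(s i) - 1 ≠ 0 := fun h => hi (by
        rw [← Real.sq_sqrt (hs0 i).le, sub_eq_zero.1 h, one_pow])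
      nlinarith [sq_pos_of_ne_zero h5, Real.sq_sqrt (hs0 i).le]
    have := Finset.prod_lt_prod (fun j _ => Real.sqrt_pos.2 (hs0 j)) (fun j _ => hle j)
      ⟨i, Finset.mem_univ i, hlt⟩
    linarith
  have hT1 : T = LinearMap.id := by
    refine LinearMap.ext fun x => ?_
    rw [← hdiagT, ← hss, show s = 1 from funext hs1, mul_one, hone, LinearMap.id_apply]
  have hT2 : LinearMap.adjoint C ∘ₗ C = LinearMap.id := (LinearMap.comp_eq_id_comm ℝ V).1 hT1
  intro u
  have h : ‖C u‖ ^ 2 = ‖u‖ ^ 2 := by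
    rw [← real_inner_self_eq_norm_sq, ← real_inner_self_eq_norm_sq,
      ← LinearMap.adjoint_inner_left, ← LinearMap.comp_apply, hT2, LinearMap.id_apply]
  exact (pow_left_inj₀ (norm_nonneg _) (norm_nonneg _) two_ne_zero).1 h

/-- If every ellipsoid in a convex set has at most the volume of the unit ball, then the unit ball is
the only unit ball that the set can contain. -/
theorem eq_zero_of_forall_abs_det_le_one {K : Set V} (hK : Convex ℝ K)
    (hball : ∀ u : V, ‖u‖ ≤ 1 → u ∈ K)
    (hmax : ∀ (M : V →ₗ[ℝ] V) (c : V), (∀ u, ‖u‖ ≤ 1 → c + M u ∈ K) → |LinearMap.det M| ≤ 1)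
    (a : V) (ha : ∀ u, ‖u‖ ≤ 1 → a + u ∈ K) : a = 0 := by
  by_contra hne
  have hpos : 0 < ‖a‖ := norm_pos_iff.2 hne
  -- Stretching the ball along `a` fits between the two balls: `|f u| ≤ 1/2` makes `a/2 + u + f u •
  -- a` a convex combination of `u` and `a + u`. The determinant is `1 + ‖a‖/2 > 1`.
  let f : Module.Dual ℝ V := (2 * ‖a‖)⁻¹ • (innerₛₗ ℝ a)
  have hf : ∀ u, f u = (2 * ‖a‖)⁻¹ * inner ℝ a u := fun u => rfl
  have h := hmax (LinearMap.transvection f a) ((1 / 2 : ℝ) • a) fun u hu => by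
    have hfu : |f u| ≤ 1 / 2 := by
      rw [hf, abs_mul, abs_of_pos (by positivity)]
      have h1 := abs_real_inner_le_norm a u
      have h2 : ‖a‖ * ‖u‖ ≤ ‖a‖ := by nlinarith
      calc (2 * ‖a‖)⁻¹ * |inner ℝ a u| ≤ (2 * ‖a‖)⁻¹ * ‖a‖ := by gcongr; linarith
        _ = 1 / 2 := by field_simp
    rw [abs_le] at hfu
    have h3 := hK (hball u hu) (ha u hu) (show 0 ≤ 1 / 2 - f u by linarith)
      (show 0 ≤ 1 / 2 + f u by linarith) (by ring)
    convert h3 using 1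
    rw [LinearMap.transvection.apply]
    module
  rw [LinearMap.transvection.det, hf, real_inner_self_eq_norm_sq] at h
  have h4 : (2 * ‖a‖)⁻¹ * ‖a‖ ^ 2 = ‖a‖ / 2 := by field_simp
  rw [h4, abs_of_pos (by positivity)] at h
  linarith

end MaximalBall

/-! ### Ellipsoids of a subspace as linear images of unit balls -/

namespace PMF2

theorem dotProduct_transpose_mul_mulVec {r : ℕ} (K : Matrix (Fin r) (Fin r) ℝ)
    (x : EuclideanSpace ℝ (Fin r)) :
    x.ofLp ⬝ᵥ ((Kᵀ * K) *ᵥ x.ofLp) = ‖Matrix.toEuclideanLin K x‖ ^ 2 := by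
  rw [← real_inner_self_eq_norm_sq, EuclideanSpace.inner_eq_star_dotProduct,
    ← Matrix.mulVec_mulVec, Matrix.dotProduct_mulVec, Matrix.vecMul_transpose]
  simp [Matrix.toLpLin_apply]

open scoped MatrixOrder Matrix.Norms.L2Operator in
/-- A positive definite quadratic form, restricted to a subspace, is a multiple of the square of the
norm after a linear change of variables. -/
theorem exists_linearEquiv_dotProduct_mulVec_eq {r : ℕ} (hr : 0 < r)
    (L : Submodule ℝ (EuclideanSpace ℝ (Fin r))) {E : Matrix (Fin r) (Fin r) ℝ} (hE : E.PosDef) :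
    ∃ (L' : Submodule ℝ (EuclideanSpace ℝ (Fin r))) (Φ : L' ≃ₗ[ℝ] L),
      ∀ u, (Φ u : EuclideanSpace ℝ (Fin r)).ofLp ⬝ᵥ
        (E *ᵥ (Φ u : EuclideanSpace ℝ (Fin r)).ofLp) = r * ‖u‖ ^ 2 := by
  obtain ⟨B, hB⟩ : ∃ B : Matrix (Fin r) (Fin r) ℝ, E = Bᵀ * B := by
    obtain ⟨B, hB⟩ := CStarAlgebra.nonneg_iff_eq_star_mul_self.1 hE.posSemidef.nonneg
    exact ⟨B, by simpa [Matrix.star_eq_conjTranspose] using hB⟩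
  have hinj : Function.Injective (Matrix.toEuclideanLin B) := by
    rw [injective_iff_map_eq_zero]
    intro x hx
    by_contra hne
    have h := hE.dotProduct_mulVec_pos (x := x.ofLp) (by simpa using hne)
    rw [star_trivial, hB, dotProduct_transpose_mul_mulVec, hx] at h
    simp at h
  have hr' : (√r : ℝ) ≠ 0 := (Real.sqrt_pos.2 (by exact_mod_cast hr)).ne'
  refine ⟨L.map (Matrix.toEuclideanLin B),
    (LinearEquiv.smulOfNeZero ℝ _ (√r : ℝ) hr').trans
      (L.equivMapOfInjective _ hinj).symm, fun u => ?_⟩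
  rw [hB, dotProduct_transpose_mul_mulVec, LinearEquiv.trans_apply]
  have h := congrArg Subtype.val
    (LinearEquiv.apply_symm_apply (L.equivMapOfInjective _ hinj)
      (LinearEquiv.smulOfNeZero ℝ _ (√r : ℝ) hr' u))
  rw [Submodule.coe_equivMapOfInjective_apply] at h
  rw [h]
  simp [norm_smul, mul_pow]

/-- Every injective linear image of a unit ball in a subspace is an ellipsoid. -/
theorem exists_posDef_ellipsoid_eq {r : ℕ} (hr : 0 < r)
    {L L' : Submodule ℝ (EuclideanSpace ℝ (Fin r))} (Ψ : L' ≃ₗ[ℝ] L)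
    (c : EuclideanSpace ℝ (Fin r)) :
    ∃ E : Matrix (Fin r) (Fin r) ℝ, E.PosDef ∧
      ellipsoid L E c = {x | ∃ u, ‖u‖ ≤ 1 ∧ x = c + Ψ u} := by
  have hr' : (0 : ℝ) < r := by exact_mod_cast hr
  set pL : EuclideanSpace ℝ (Fin r) →ₗ[ℝ] L := L.orthogonalProjectionOnto.toLinearMap with hpL
  have hp : ∀ x : L, pL x = x := fun x => L.orthogonalProjectionOnto_mem_subspace_eq_self x
  set K₁ := Matrix.toEuclideanLin.symm (L'.subtype ∘ₗ Ψ.symm.toLinearMap ∘ₗ pL) with hK₁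
  -- The form from `K₂` vanishes on `L` and is positive on the nonzero vectors of its orthogonal
  -- complement. It makes the matrix definite on the whole space without changing the ellipsoid.
  set K₂ := Matrix.toEuclideanLin.symm
    (LinearMap.id - L.subtype ∘ₗ pL) with hK₂
  have hq : ∀ x : EuclideanSpace ℝ (Fin r),
      x.ofLp ⬝ᵥ (((r : ℝ) • (K₁ᵀ * K₁) + K₂ᵀ * K₂) *ᵥ x.ofLp) =
        r * ‖Ψ.symm (pL x)‖ ^ 2 + ‖x - pL x‖ ^ 2 := fun x => by
    rw [Matrix.add_mulVec, Matrix.smul_mulVec, dotProduct_add, dotProduct_smul,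
      dotProduct_transpose_mul_mulVec, dotProduct_transpose_mul_mulVec, hK₁, hK₂,
      LinearEquiv.apply_symm_apply, LinearEquiv.apply_symm_apply]
    simp
  refine ⟨(r : ℝ) • (K₁ᵀ * K₁) + K₂ᵀ * K₂, ?_, ?_⟩
  · refine Matrix.PosDef.of_dotProduct_mulVec_pos ?_ fun x hx => ?_
    · rw [Matrix.IsHermitian, Matrix.conjTranspose_eq_transpose_of_trivial]
      simp
    · have h := hq (WithLp.toLp 2 x)
      rw [star_trivial]
      change x ⬝ᵥ _ = _ at h
      rw [h]
      by_cases h0 : pL (WithLp.toLp 2 x) = 0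
      · have : 0 < ‖WithLp.toLp 2 x‖ := norm_pos_iff.2 (by simpa using hx)
        simp only [h0, map_zero, norm_zero, ZeroMemClass.coe_zero, sub_zero]
        positivity
      · have : 0 < ‖Ψ.symm (pL (WithLp.toLp 2 x))‖ := norm_pos_iff.2 (by simpa using h0)
        positivity
  · ext x
    simp only [ellipsoid, Set.mem_ofPred_eq]
    constructor
    · rintro ⟨hx, hle⟩
      rw [hq, hp ⟨x - c, hx⟩] at hle
      refine ⟨Ψ.symm ⟨x - c, hx⟩, ?_, by simp⟩
      have h1 : r * ‖Ψ.symm ⟨x - c, hx⟩‖ ^ 2 ≤ r * 1 := by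
        simpa using hle
      have h2 := le_of_mul_le_mul_left h1 hr'
      exact (sq_le_one_iff₀ (norm_nonneg _)).1 h2
    · rintro ⟨u, hu, rfl⟩
      rw [hq]
      simp only [add_sub_cancel_left, hp, LinearEquiv.symm_apply_apply, sub_self, norm_zero]
      refine ⟨(Ψ u).2, ?_⟩
      have h2 := (sq_le_one_iff₀ (norm_nonneg u)).2 hu
      nlinarith

/-- A maximum-volume inscribed ellipsoid is the image of a unit ball under an affine map, after which
every inscribed ellipsoid is the image of that ball under a map of determinant at most `1`. -/
theorem IsMVIE.exists_linearEquiv {r : ℕ} (hr : 0 < r) {P S : Set (EuclideanSpace ℝ (Fin r))}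
    {g : EuclideanSpace ℝ (Fin r)} (h : IsMVIE P S g) :
    ∃ (L' : Submodule ℝ (EuclideanSpace ℝ (Fin r))) (Φ : L' ≃ₗ[ℝ] vectorSpan ℝ P),
      S = {x | ∃ u, ‖u‖ ≤ 1 ∧ x = g + Φ u} ∧
      ∀ (M : L' →ₗ[ℝ] L') (c : EuclideanSpace ℝ (Fin r)),
        (∀ u, ‖u‖ ≤ 1 → c + Φ (M u) ∈ P) → |LinearMap.det M| ≤ 1 := by
  obtain ⟨E, hE, hS⟩ := h.isEllipsoid
  obtain ⟨L', Φ, hΦ⟩ := exists_linearEquiv_dotProduct_mulVec_eq hr (vectorSpan ℝ P) hE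
  have hr' : (0 : ℝ) < r := by exact_mod_cast hr
  have hSeq : S = {x | ∃ u, ‖u‖ ≤ 1 ∧ x = g + Φ u} := by
    rw [hS]
    ext x
    simp only [ellipsoid, Set.mem_ofPred_eq]
    have key : ∀ u, (Φ u : EuclideanSpace ℝ (Fin r)).ofLp ⬝ᵥ
        (E *ᵥ (Φ u : EuclideanSpace ℝ (Fin r)).ofLp) ≤ r ↔ ‖u‖ ≤ 1 := fun u => by
      rw [hΦ, ← sq_le_one_iff₀ (norm_nonneg u)]
      constructor <;> intro h <;> nlinarith
    constructor
    · rintro ⟨hx, hle⟩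
      refine ⟨Φ.symm ⟨x - g, hx⟩, ?_, by simp⟩
      rw [← key]
      simpa using hle
    · rintro ⟨u, hu, rfl⟩
      rw [add_sub_cancel_left]
      exact ⟨(Φ u).2, (key u).2 hu⟩
  refine ⟨L', Φ, hSeq, fun M c hM => ?_⟩
  -- For singular `M` the image of the ball is degenerate and not an `ellipsoid`, so maximality
  -- cannot be applied to it.
  by_cases hdet : LinearMap.det M = 0
  · simp [hdet]
  set B : Set (vectorSpan ℝ P) := Φ '' Metric.closedBall 0 1 with hB
  have hvol : ∀ (N : vectorSpan ℝ P →ₗ[ℝ] vectorSpan ℝ P) (c : EuclideanSpace ℝ (Fin r)),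
      μHE[Module.finrank ℝ (vectorSpan ℝ P)]
        {x : EuclideanSpace ℝ (Fin r) | ∃ u, ‖u‖ ≤ 1 ∧ x = c + N (Φ u)} =
      ENNReal.ofReal |LinearMap.det N| * μHE[Module.finrank ℝ (vectorSpan ℝ P)] B := by
    intro N c
    rw [← MeasureTheory.Measure.addHaar_image_linearMap]
    have hiso : Isometry fun x : vectorSpan ℝ P => c + (x : EuclideanSpace ℝ (Fin r)) :=
      (isometry_add_left c).comp isometry_subtype_coe
    rw [← hiso.euclideanHausdorffMeasure_image]
    congr 1
    ext x
    constructor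
    · rintro ⟨u, hu, rfl⟩
      exact ⟨_, ⟨_, ⟨u, mem_closedBall_zero_iff.2 hu, rfl⟩, rfl⟩, rfl⟩
    · rintro ⟨_, ⟨_, ⟨u, hu, rfl⟩, rfl⟩, rfl⟩
      exact ⟨u, mem_closedBall_zero_iff.1 hu, rfl⟩
  set Ψ : L' ≃ₗ[ℝ] vectorSpan ℝ P :=
    (M.equivOfDetNeZero hdet).trans Φ with hΨ
  have hΨM : ∀ u, Ψ u = Φ (M u) := fun u => rfl
  obtain ⟨E', hE', hell⟩ := exists_posDef_ellipsoid_eq hr Ψ c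
  have hmax := h.maximal E' c hE' (by
    rw [hell]
    rintro x ⟨u, hu, rfl⟩
    exact hM u hu)
  have h1 := hvol LinearMap.id g
  have h2 := hvol (Φ.toLinearMap ∘ₗ M ∘ₗ Φ.symm.toLinearMap) c
  simp only [LinearMap.id_apply, ← hSeq, LinearMap.det_id, abs_one, ENNReal.ofReal_one,
    one_mul] at h1
  simp only [LinearMap.comp_apply, LinearEquiv.coe_coe, LinearEquiv.symm_apply_apply,
    LinearMap.det_conj, ← hΨM, ← hell] at h2
  rw [h1, h2] at hmax
  have hΦc : Continuous Φ := Φ.toLinearMap.continuous_of_finiteDimensional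
  have hfin : μHE[Module.finrank ℝ (vectorSpan ℝ P)] B ≠ ⊤ :=
    ((isCompact_closedBall 0 1).image hΦc).measure_lt_top.ne
  have hpos : μHE[Module.finrank ℝ (vectorSpan ℝ P)] B ≠ 0 := by
    have hopen : IsOpen (Φ '' Metric.ball 0 1) :=
      Φ.toContinuousLinearEquiv.toHomeomorph.isOpenMap _ Metric.isOpen_ball
    have h3 := hopen.measure_pos μHE[Module.finrank ℝ (vectorSpan ℝ P)]
      ((Metric.nonempty_ball.2 one_pos).image _)
    exact (h3.trans_le (MeasureTheory.measure_mono
      (Set.image_mono Metric.ball_subset_closedBall))).ne'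
  have h4 : ENNReal.ofReal |LinearMap.det M| ≤ 1 := by
    rw [← ENNReal.mul_le_mul_iff_left hpos hfin, one_mul]
    exact hmax
  simpa using h4

end PMF2

/-! ### Linear maps that send the MVIE into the polytope -/

namespace PMF2

/-- A linear map that sends a maximum-volume inscribed ellipsoid of a spanning convex set into that
set has determinant at most `1`; if the determinant is `±1`, the ellipsoid is invariant. -/
theorem IsMVIE.map_subset {r : ℕ} (hr : 0 < r) {P S : Set (EuclideanSpace ℝ (Fin r))}
    {g : EuclideanSpace ℝ (Fin r)} (h : IsMVIE P S g) (hP : Convex ℝ P)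
    (hspan : Submodule.span ℝ P = ⊤)
    (T : EuclideanSpace ℝ (Fin r) →ₗ[ℝ] EuclideanSpace ℝ (Fin r)) (hT : ∀ x ∈ S, T x ∈ P) :
    (∀ v ∈ vectorSpan ℝ P, T v ∈ vectorSpan ℝ P) ∧ |LinearMap.det T| ≤ 1 ∧
      (|LinearMap.det T| = 1 → T g = g ∧ T '' S = S) := by
  obtain ⟨L', Φ, hS, hmax⟩ := h.exists_linearEquiv hr
  have hmem : ∀ u, ‖u‖ ≤ 1 → g + (Φ u : EuclideanSpace ℝ (Fin r)) ∈ S := fun u hu => by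
    rw [hS]; exact ⟨u, hu, rfl⟩
  have hgS : g ∈ S := by simpa using hmem 0 (by simp)
  have hgP := h.subset hgS
  have hTg : T g - g ∈ vectorSpan ℝ P := vsub_mem_vectorSpan ℝ (hT g hgS) hgP
  have hTΦ : ∀ u : L', ‖u‖ ≤ 1 → T (Φ u) ∈ vectorSpan ℝ P := fun u hu => by
    have := vsub_mem_vectorSpan ℝ (hT _ (hmem u hu)) (hT g hgS)
    simpa using this
  have hTL : ∀ v ∈ vectorSpan ℝ P, T v ∈ vectorSpan ℝ P := fun v hv => by
    obtain ⟨u, hu⟩ := Φ.surjective ⟨v, hv⟩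
    by_cases h0 : u = 0
    · have : v = 0 := by simpa [h0] using congrArg Subtype.val hu.symm
      simp [this]
    · have hn : ‖u‖ ≠ 0 := norm_ne_zero_iff.2 h0
      have h1 := hTΦ (‖u‖⁻¹ • u) (by rw [norm_smul, norm_inv, norm_norm, inv_mul_cancel₀ hn])
      rw [map_smul, hu, Submodule.coe_smul, map_smul] at h1
      simpa only [smul_inv_smul₀ hn] using Submodule.smul_mem _ ‖u‖ h1
  have hle : vectorSpan ℝ P ≤ (vectorSpan ℝ P).comap T := hTL
  -- `T x - x` lies in the direction space for every `x ∈ P`, and `P` spans. So `T` acts trivially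
  -- on the quotient, and its determinant equals that of its restriction.
  have hquot : (vectorSpan ℝ P).mapQ (vectorSpan ℝ P) T hle = LinearMap.id := by
    refine LinearMap.ext fun x => ?_
    obtain ⟨x, rfl⟩ := Submodule.Quotient.mk_surjective _ x
    rw [Submodule.mapQ_apply, LinearMap.id_apply, Submodule.Quotient.eq]
    have hx : x ∈ Submodule.span ℝ P := hspan ▸ Submodule.mem_top
    induction hx using Submodule.span_induction with
    | mem x hx =>
      have hxg : x - g ∈ vectorSpan ℝ P := vsub_mem_vectorSpan ℝ hx hgP
      have h1 := add_mem (sub_mem (hTL _ hxg) hxg) hTg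
      rw [map_sub] at h1
      convert h1 using 1
      abel
    | zero => simp
    | add x y _ _ hx hy =>
      have h1 := add_mem hx hy
      rw [map_add]
      convert h1 using 1
      abel
    | smul c x _ hx =>
      rw [map_smul, ← smul_sub]
      exact Submodule.smul_mem _ _ hx
  set C : L' →ₗ[ℝ] L' := Φ.symm.toLinearMap ∘ₗ T.restrict hle ∘ₗ Φ.symm.symm.toLinearMap with hC
  have hdet : LinearMap.det C = LinearMap.det T := by
    rw [hC, LinearMap.det_conj, T.det_eq_det_mul_det _ hle, hquot, LinearMap.det_id, mul_one]
  have hΦC : ∀ u, (Φ (C u) : EuclideanSpace ℝ (Fin r)) = T (Φ u) := fun u => by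
    simp [hC]
  have hTS : ∀ u : L', ‖u‖ ≤ 1 → T g + Φ (C u) ∈ P := fun u hu => by
    rw [hΦC, ← map_add]
    exact hT _ (hmem u hu)
  refine ⟨hTL, hdet ▸ hmax C _ hTS, fun h1 => ?_⟩
  let K : Set L' := {u | g + (Φ u : EuclideanSpace ℝ (Fin r)) ∈ P}
  have hK : Convex ℝ K := by
    intro u hu v hv a b ha hb hab
    have h2 := hP hu hv ha hb hab
    change g + (Φ (a • u + b • v) : EuclideanSpace ℝ (Fin r)) ∈ P
    convert h2 using 1
    rw [map_add, map_smul, map_smul]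
    simp only [Submodule.coe_add, Submodule.coe_smul, smul_add]
    rw [add_add_add_comm, ← add_smul, hab, one_smul]
  have hball : ∀ u : L', ‖u‖ ≤ 1 → u ∈ K := fun u hu => h.subset (hmem u hu)
  have hmaxK : ∀ (M : L' →ₗ[ℝ] L') (c : L'), (∀ u, ‖u‖ ≤ 1 → c + M u ∈ K) →
      |LinearMap.det M| ≤ 1 := fun M c hM =>
    hmax M (g + Φ c) fun u hu => by
      have h2 : g + (Φ (c + M u) : EuclideanSpace ℝ (Fin r)) ∈ P := hM u hu
      rwa [map_add, Submodule.coe_add, ← add_assoc] at h2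
  have hCK : ∀ u : L', ‖u‖ ≤ 1 → Φ.symm ⟨T g - g, hTg⟩ + C u ∈ K := fun u hu => by
    change g + (Φ (_ + C u) : EuclideanSpace ℝ (Fin r)) ∈ P
    convert hTS u hu using 1
    rw [map_add, LinearEquiv.apply_symm_apply, Submodule.coe_add]
    change g + (T g - g + _) = _
    abel
  have hnorm := norm_map_eq_of_forall_abs_det_le_one hK hball hmaxK C _ hCK (hdet ▸ h1)
  have hCinj : Function.Injective C := (injective_iff_map_eq_zero C).2 fun u hu => by
    rw [← norm_eq_zero, ← hnorm, hu, norm_zero]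
  have hCsurj : Function.Surjective C := LinearMap.surjective_of_injective hCinj
  have hzero := eq_zero_of_forall_abs_det_le_one hK hball hmaxK (Φ.symm ⟨T g - g, hTg⟩)
    fun u hu => by
      obtain ⟨w, rfl⟩ := hCsurj u
      exact hCK w (hnorm w ▸ hu)
  have hTgg : T g = g := by
    have h2 : (⟨T g - g, hTg⟩ : vectorSpan ℝ P) = 0 := by simpa using hzero
    exact sub_eq_zero.1 (congrArg Subtype.val h2)
  refine ⟨hTgg, ?_⟩
  rw [hS]
  apply Set.Subset.antisymm
  · rintro _ ⟨_, ⟨u, hu, rfl⟩, rfl⟩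
    exact ⟨C u, (hnorm u).trans_le hu, by rw [map_add, hTgg, hΦC]⟩
  · rintro _ ⟨u, hu, rfl⟩
    obtain ⟨w, rfl⟩ := hCsurj u
    exact ⟨g + Φ w, ⟨w, hnorm w ▸ hu, rfl⟩, by rw [map_add, hTgg, hΦC]⟩

/-- A maximum-volume inscribed ellipsoid contains a ball of the affine hull around its centre. -/
theorem IsMVIE.exists_ball {r : ℕ} (hr : 0 < r) {P S : Set (EuclideanSpace ℝ (Fin r))}
    {g : EuclideanSpace ℝ (Fin r)} (h : IsMVIE P S g) :
    ∃ δ > 0, ∀ v ∈ vectorSpan ℝ P, ‖v‖ ≤ δ → g + v ∈ S := by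
  obtain ⟨L', Φ, hS, -⟩ := h.exists_linearEquiv hr
  have hc : Filter.Tendsto Φ.symm (nhds 0) (nhds 0) := by
    simpa using (Φ.symm.toLinearMap.continuous_of_finiteDimensional).tendsto 0
  obtain ⟨ε, hε, hsub⟩ := Metric.eventually_nhds_iff.1
    (hc.eventually (Metric.closedBall_mem_nhds 0 one_pos))
  refine ⟨ε / 2, half_pos hε, fun v hv hle => ?_⟩
  rw [hS]
  refine ⟨Φ.symm ⟨v, hv⟩, ?_, by simp⟩
  have := @hsub ⟨v, hv⟩ (by rw [dist_zero_right]; exact hle.trans_lt (half_lt_self hε))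
  simpa using this

/-! ### Polars relative to a subspace -/

section Polar

variable {r : ℕ} {L : Submodule ℝ (EuclideanSpace ℝ (Fin r))} {g : EuclideanSpace ℝ (Fin r)}

theorem polarAt_anti {K Q : Set (EuclideanSpace ℝ (Fin r))} (h : K ⊆ Q) :
    polarAt L g Q ⊆ polarAt L g K := fun _ hx => ⟨hx.1, fun y hy => hx.2 y (h hy)⟩

theorem convex_polarAt (K : Set (EuclideanSpace ℝ (Fin r))) : Convex ℝ (polarAt L g K) := by
  intro x hx y hy a b ha hb hab
  refine ⟨add_mem (L.smul_mem _ hx.1) (L.smul_mem _ hy.1), fun z hz => ?_⟩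
  rw [inner_add_left, real_inner_smul_left, real_inner_smul_left]
  nlinarith [hx.2 z hz, hy.2 z hz]

theorem isClosed_polarAt (K : Set (EuclideanSpace ℝ (Fin r))) : IsClosed (polarAt L g K) := by
  have : polarAt L g K = (L : Set (EuclideanSpace ℝ (Fin r))) ∩
      ⋂ y ∈ K, {x | inner ℝ x (y - g) ≤ 1} := by
    ext x
    simp [polarAt]
  rw [this]
  exact L.closed_of_finiteDimensional.inter (isClosed_biInter fun y _ =>
    isClosed_le (by fun_prop) continuous_const)

/-- Testing `x ≠ 0` against the point `g + δ x / ‖x‖` of `K` gives `‖x‖ ≤ δ⁻¹`. Compactness is what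
Krein–Milman needs later. -/
theorem isCompact_polarAt {K : Set (EuclideanSpace ℝ (Fin r))}
    (hK : ∃ δ > 0, ∀ v ∈ L, ‖v‖ ≤ δ → g + v ∈ K) : IsCompact (polarAt L g K) := by
  obtain ⟨δ, hδ, hK⟩ := hK
  refine Metric.isCompact_of_isClosed_isBounded (isClosed_polarAt K)
    ((Metric.isBounded_closedBall (x := 0) (r := δ⁻¹)).subset fun x hx => ?_)
  rw [mem_closedBall_zero_iff]
  by_cases h0 : x = 0
  · simp [h0, hδ.le]
  have hn : ‖x‖ ≠ 0 := norm_ne_zero_iff.2 h0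
  have h1 := hx.2 _ (hK ((δ * ‖x‖⁻¹) • x) (L.smul_mem _ hx.1)
    (by rw [norm_smul, norm_mul, norm_inv, norm_norm, mul_assoc, inv_mul_cancel₀ hn, mul_one,
          Real.norm_of_nonneg hδ.le]))
  rw [add_sub_cancel_left, real_inner_smul_right, real_inner_self_eq_norm_sq] at h1
  rw [← one_div, le_div_iff₀ hδ]
  calc ‖x‖ * δ = δ * ‖x‖⁻¹ * ‖x‖ ^ 2 := by field_simp
    _ ≤ 1 := h1

/-- The polar of a polytope has finitely many extreme points. -/
theorem finite_extremePoints_polarAt {P : Set (EuclideanSpace ℝ (Fin r))} (hP : IsPolytope P) :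
    ((polarAt L g P).extremePoints ℝ).Finite := by
  obtain ⟨V, rfl⟩ := hP
  set P := convexHull ℝ (V : Set (EuclideanSpace ℝ (Fin r)))
  have hmem : ∀ x ∈ L, (∀ v ∈ V, inner ℝ x (v - g) ≤ 1) → x ∈ polarAt L g P := by
    intro x hx h
    refine ⟨hx, fun y hy => ?_⟩
    have hconv : Convex ℝ {y | inner ℝ x (y - g) ≤ 1} := by
      simp_rw [inner_sub_right, sub_le_iff_le_add]
      exact convex_halfSpace_le (innerₛₗ ℝ x).isLinear _
    exact convexHull_min (show (V : Set _) ⊆ {y | inner ℝ x (y - g) ≤ 1} from h) hconv hy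
  classical
  refine Set.Finite.of_finite_image (f := fun x => V.filter fun v => inner ℝ x (v - g) = 1)
    ((V.powerset.finite_toSet).subset ?_) ?_
  · rintro _ ⟨x, -, rfl⟩
    exact Finset.mem_powerset.2 (Finset.filter_subset _ _)
  -- An extreme point is determined by its active constraints: if those of `x` are also active at
  -- `y`, a short step from `x` away from `y` stays in the polar, so `x` is interior to a segment
  -- starting at `y` unless `x = y`.
  · intro x hx y hy hxy
    have hact : ∀ v ∈ V, inner ℝ x (v - g) = 1 → inner ℝ y (v - g) = 1 := fun v hv h => by
      have : v ∈ V.filter fun v => inner ℝ x (v - g) = 1 := Finset.mem_filter.2 ⟨hv, h⟩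
      rw [show (V.filter fun v => inner ℝ x (v - g) = 1) = _ from hxy] at this
      exact (Finset.mem_filter.1 this).2
    have hev : ∀ᶠ ε : ℝ in nhdsWithin 0 (Set.Ioi 0), ∀ v ∈ V,
        inner ℝ (x + ε • (x - y)) (v - g) ≤ 1 := by
      rw [Filter.eventually_all_finset]
      intro v hv
      by_cases h1 : inner ℝ x (v - g) = 1
      · refine Filter.Eventually.of_forall fun ε => ?_
        rw [inner_add_left, real_inner_smul_left, inner_sub_left, hact v hv h1, h1]
        simp
      · have hlt : inner ℝ x (v - g) < 1 :=
          lt_of_le_of_ne (hx.1.2 v (subset_convexHull ℝ _ hv)) h1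
        have hcont : Continuous fun ε : ℝ => inner ℝ (x + ε • (x - y)) (v - g) := by fun_prop
        have := (hcont.tendsto 0).eventually_lt_const (by simpa using hlt)
        exact (this.filter_mono nhdsWithin_le_nhds).mono fun _ h => h.le
    obtain ⟨ε, hε, hpos⟩ := (hev.and self_mem_nhdsWithin).exists
    have hpos : 0 < ε := hpos
    have hz : x + ε • (x - y) ∈ polarAt L g P :=
      hmem _ (add_mem hx.1.1 (L.smul_mem _ (sub_mem hx.1.1 hy.1.1))) hε
    have hseg : x ∈ openSegment ℝ y (x + ε • (x - y)) := by
      refine ⟨ε / (1 + ε), 1 / (1 + ε), by positivity, by positivity, by field_simp; ring, ?_⟩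
      have h1 : (1 + ε) ≠ 0 := by positivity
      have h2 : ε / (1 + ε) = 1 - 1 / (1 + ε) := by field_simp; ring
      have h3 : 1 / (1 + ε) * ε = 1 - 1 / (1 + ε) := by field_simp; ring
      rw [smul_add, smul_smul, h3, h2]
      module
    exact (hx.2 hy.1 hz hseg).symm

/-- The bipolar theorem. -/
theorem mem_iff_forall_polarAt {K : Set (EuclideanSpace ℝ (Fin r))} (hK : Convex ℝ K)
    (hcl : IsClosed K) (hg : g ∈ K) (hL : ∀ y ∈ K, y - g ∈ L) {y : EuclideanSpace ℝ (Fin r)}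
    (hy : y - g ∈ L) : y ∈ K ↔ ∀ x ∈ polarAt L g K, inner ℝ x (y - g) ≤ 1 := by
  refine ⟨fun h x hx => hx.2 y h, fun h => ?_⟩
  by_contra hne
  obtain ⟨f, u, hfu, huf⟩ := geometric_hahn_banach_closed_point hK hcl hne
  set z := (InnerProductSpace.toDual ℝ (EuclideanSpace ℝ (Fin r))).symm f with hz
  have hzf : ∀ x, inner ℝ z x = f x := fun x => InnerProductSpace.toDual_symm_apply
  -- The separating functional, projected to `L` and divided by this gap, is a point of the polar
  -- that violates `h`.
  have hs : 0 < u - f g := sub_pos.2 (hfu g hg)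
  set p : EuclideanSpace ℝ (Fin r) := ↑(L.orthogonalProjectionOnto z) with hp
  have hin : ∀ w, w - g ∈ L → inner ℝ p (w - g) = f w - f g := fun w hw => by
    rw [← map_sub, ← hzf, hp]
    exact Submodule.inner_orthogonalProjectionOnto_eq_of_mem_right ⟨w - g, hw⟩ z
  have hmem : (u - f g)⁻¹ • p ∈ polarAt L g K := by
    refine ⟨L.smul_mem _ (Subtype.coe_prop _), fun w hw => ?_⟩
    rw [real_inner_smul_left, hin w (hL w hw), inv_mul_le_iff₀ hs, mul_one]
    linarith [hfu w hw]
  have h1 := h _ hmem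
  rw [real_inner_smul_left, hin y hy, inv_mul_le_iff₀ hs, mul_one] at h1
  linarith

/-- The adjoint on an invariant subspace, extended to an automorphism of the whole space. -/
theorem exists_linearEquiv_adjoint_on
    (T : EuclideanSpace ℝ (Fin r) →ₗ[ℝ] EuclideanSpace ℝ (Fin r)) (hT : Function.Injective T)
    (hTL : ∀ v ∈ L, T v ∈ L) :
    ∃ D : EuclideanSpace ℝ (Fin r) ≃ₗ[ℝ] EuclideanSpace ℝ (Fin r),
      (∀ x, D x ∈ L ↔ x ∈ L) ∧ ∀ x ∈ L, ∀ v ∈ L, inner ℝ (D x) v = inner ℝ x (T v) := by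
  set pL : EuclideanSpace ℝ (Fin r) →ₗ[ℝ] L := L.orthogonalProjectionOnto.toLinearMap with hpL
  have hp : ∀ x ∈ L, (pL x : EuclideanSpace ℝ (Fin r)) = x := fun x hx =>
    congrArg Subtype.val (L.orthogonalProjectionOnto_mem_subspace_eq_self ⟨x, hx⟩)
  -- The adjoint of `T` restricted to `L`, plus the identity on the orthogonal complement. A global
  -- automorphism is convenient for transporting the intrinsic frontier.
  set D : EuclideanSpace ℝ (Fin r) →ₗ[ℝ] EuclideanSpace ℝ (Fin r) :=
    L.subtype ∘ₗ pL ∘ₗ LinearMap.adjoint T ∘ₗ L.subtype ∘ₗ pL +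
      (LinearMap.id - L.subtype ∘ₗ pL) with hD
  have hDx : ∀ x, D x = pL (LinearMap.adjoint T (pL x)) + (x - pL x) := fun x => rfl
  have hDL : ∀ x, D x ∈ L ↔ x ∈ L := fun x => by
    rw [hDx, L.add_mem_iff_right (Subtype.coe_prop _), L.sub_mem_iff_left (Subtype.coe_prop _)]
  have hin : ∀ x ∈ L, ∀ v ∈ L, inner ℝ (D x) v = inner ℝ x (T v) := fun x hx v hv => by
    rw [hDx, hp x hx, sub_self, add_zero, ← LinearMap.adjoint_inner_left]
    exact Submodule.inner_orthogonalProjectionOnto_eq_of_mem_right ⟨v, hv⟩ _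
  have hsurj : Function.Surjective (T.restrict hTL) :=
    LinearMap.surjective_of_injective fun a b hab =>
      Subtype.ext (hT (congrArg Subtype.val hab))
  have hinj : Function.Injective D := (injective_iff_map_eq_zero D).2 fun x hx => by
    have hxL : x ∈ L := (hDL x).1 (hx ▸ L.zero_mem)
    obtain ⟨v, hv⟩ := hsurj ⟨x, hxL⟩
    have h1 := hin x hxL v v.2
    have hv' : T v = x := congrArg Subtype.val hv
    rw [hx, hv', inner_zero_left] at h1
    exact inner_self_eq_zero.1 h1.symm
  exact ⟨LinearEquiv.ofInjectiveEndo D hinj, hDL, hin⟩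

/-- As `T` fixes `g`, `⟨x, T y - g⟩ = ⟨x, T (y - g)⟩ = ⟨D x, y - g⟩`, so the constraints defining
the two polars correspond under `D`. -/
theorem image_polarAt_image
    {T : EuclideanSpace ℝ (Fin r) →ₗ[ℝ] EuclideanSpace ℝ (Fin r)} (hTg : T g = g)
    {D : EuclideanSpace ℝ (Fin r) ≃ₗ[ℝ] EuclideanSpace ℝ (Fin r)} (hDL : ∀ x, D x ∈ L ↔ x ∈ L)
    (hD : ∀ x ∈ L, ∀ v ∈ L, inner ℝ (D x) v = inner ℝ x (T v))
    {K : Set (EuclideanSpace ℝ (Fin r))} (hK : ∀ y ∈ K, y - g ∈ L) :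
    D '' polarAt L g (T '' K) = polarAt L g K := by
  have key : ∀ x, D x ∈ polarAt L g K ↔ x ∈ polarAt L g (T '' K) := fun x => by
    change _ ∧ _ ↔ _ ∧ _
    rw [hDL x]
    refine and_congr_right fun hx => ?_
    rw [Set.forall_mem_image]
    refine forall₂_congr fun y hy => ?_
    rw [hD x hx _ (hK y hy), map_sub, hTg]
  ext x
  obtain ⟨x, rfl⟩ := D.surjective x
  rw [key, Function.Injective.mem_set_image D.injective]

end Polar

end PMF2

/-! ### From the scattering conditions to invariance of the polytope -/

namespace PMF2

theorem IsPolytope.convex {r : ℕ} {P : Set (EuclideanSpace ℝ (Fin r))} (hP : IsPolytope P) :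
    Convex ℝ P := by
  obtain ⟨V, rfl⟩ := hP
  exact convex_convexHull ℝ _

theorem IsPolytope.isCompact {r : ℕ} {P : Set (EuclideanSpace ℝ (Fin r))} (hP : IsPolytope P) :
    IsCompact P := by
  obtain ⟨V, rfl⟩ := hP
  exact V.finite_toSet.isCompact_convexHull (𝕜 := ℝ)

theorem toEuclideanLin_col {r n : ℕ} (B : Matrix (Fin r) (Fin r) ℝ) (M : Matrix (Fin r) (Fin n) ℝ)
    (j : Fin n) :
    Matrix.toEuclideanLin B (WithLp.toLp 2 (M.col j)) = WithLp.toLp 2 ((B * M).col j) := by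
  rw [Matrix.toLpLin_apply]
  rfl

theorem span_columnSet_eq_top {r n : ℕ} {M : Matrix (Fin r) (Fin n) ℝ}
    {R : Matrix (Fin n) (Fin r) ℝ} (hR : M * R = 1) :
    Submodule.span ℝ (columnSet M) = ⊤ := by
  refine Submodule.eq_top_iff'.2 fun x => ?_
  have hx : x = ∑ j, (R *ᵥ x.ofLp) j • WithLp.toLp 2 (M.col j) := by
    have h : x.ofLp = M *ᵥ (R *ᵥ x.ofLp) := by
      rw [Matrix.mulVec_mulVec, hR, Matrix.one_mulVec]
    ext i
    conv_lhs => rw [h]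
    simp [Matrix.mulVec, dotProduct, mul_comm]
  rw [hx]
  exact Submodule.sum_mem _ fun j _ =>
    Submodule.smul_mem _ _ (Submodule.subset_span ⟨j, rfl⟩)

/-- A linear map that sends the columns of a sufficiently scattered factor into the polytope has
determinant at most `1`, and it preserves the polytope if the determinant is `±1`. -/
theorem IsSSF.map_columns {r n : ℕ} (hr : 0 < r) {M : Matrix (Fin r) (Fin n) ℝ}
    {P : Set (EuclideanSpace ℝ (Fin r))} (hM : IsSSF M P) (hP : IsPolytope P)
    {R : Matrix (Fin n) (Fin r) ℝ} (hR : M * R = 1) (B : Matrix (Fin r) (Fin r) ℝ)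
    (hB : ∀ j, WithLp.toLp 2 ((B * M).col j) ∈ P) :
    |B.det| ≤ 1 ∧ (|B.det| = 1 → Matrix.toEuclideanLin B '' P = P) := by
  obtain ⟨S, g, hS, ⟨hMP, hSM⟩, hssc⟩ := hM
  set T := Matrix.toEuclideanLin B with hT
  have hTdet : LinearMap.det T = B.det := LinearMap.det_toLpLin 2 B
  have hTM : T '' conv M ⊆ P := by
    rw [conv, LinearMap.image_convexHull]
    refine convexHull_min ?_ hP.convex
    rintro _ ⟨_, ⟨j, rfl⟩, rfl⟩
    change T (WithLp.toLp 2 (M.col j)) ∈ P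
    rw [hT, toEuclideanLin_col]
    exact hB j
  have hspan : Submodule.span ℝ P = ⊤ :=
    top_le_iff.1 ((span_columnSet_eq_top hR).symm.le.trans
      (Submodule.span_mono ((subset_convexHull ℝ _).trans hMP)))
  obtain ⟨hTL, hle, heq⟩ := hS.map_subset hr hP.convex hspan T
    fun x hx => hTM (Set.mem_image_of_mem T (hSM hx))
  rw [hTdet] at hle heq
  refine ⟨hle, fun h1 => ?_⟩
  obtain ⟨hTg, hTS⟩ := heq h1
  obtain ⟨δ, hδ, hball⟩ := hS.exists_ball hr
  have hgP : g ∈ P := hS.subset (by simpa using hball 0 (zero_mem _) (by simpa using hδ.le))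
  have hTinj : Function.Injective T := by
    have hdet : LinearMap.det T ≠ 0 := fun h0 => by
      rw [hTdet] at h0
      simp [h0] at h1
    exact (T.equivOfDetNeZero hdet).injective
  have hPL : ∀ y ∈ P, y - g ∈ vectorSpan ℝ P := fun y hy => vsub_mem_vectorSpan ℝ hy hgP
  obtain ⟨D, hDL, hD⟩ := exists_linearEquiv_adjoint_on (L := vectorSpan ℝ P) T hTinj hTL
  have himage : ∀ {K : Set (EuclideanSpace ℝ (Fin r))}, K ⊆ P →
      D '' polarAt (vectorSpan ℝ P) g (T '' K) = polarAt (vectorSpan ℝ P) g K := fun hK =>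
    image_polarAt_image hTg hDL hD fun y hy => hPL y (hK hy)
  have hDS : D '' polarAt (vectorSpan ℝ P) g S = polarAt (vectorSpan ℝ P) g S := by
    have h2 := himage hS.subset
    rwa [hTS] at h2
  -- SSC2 is used in both directions: it puts `x` on the boundary of the polar of `S`, which `D`
  -- preserves, and it turns membership of `D x` in the polar of `conv M` and in that boundary back
  -- into extremality.
  have hmaps : Set.MapsTo D ((polarAt (vectorSpan ℝ P) g P).extremePoints ℝ)
      ((polarAt (vectorSpan ℝ P) g P).extremePoints ℝ) := fun x hx => by
    have hxP := hx.1
    rw [← hssc] at hx ⊢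
    refine ⟨?_, ?_⟩
    · rw [← himage hMP]
      exact Set.mem_image_of_mem D (polarAt_anti hTM hxP)
    · have h2 := D.toAffineEquiv.intrinsicFrontier_image (polarAt (vectorSpan ℝ P) g S)
      rw [LinearEquiv.coe_toAffineEquiv, hDS] at h2
      rw [h2]
      exact Set.mem_image_of_mem D hx.2
  have hDext : D '' (polarAt (vectorSpan ℝ P) g P).extremePoints ℝ =
      (polarAt (vectorSpan ℝ P) g P).extremePoints ℝ :=
    Set.eq_of_subset_of_ncard_le hmaps.image_subset
      (Set.ncard_image_of_injective _ D.injective).ge (finite_extremePoints_polarAt hP)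
  have hDP : D '' polarAt (vectorSpan ℝ P) g P = polarAt (vectorSpan ℝ P) g P := by
    have hcomp : IsCompact (polarAt (vectorSpan ℝ P) g P) :=
      isCompact_polarAt ⟨δ, hδ, fun v hv hle => hS.subset (hball v hv hle)⟩
    rw [← closure_convexHull_extremePoints hcomp (convex_polarAt P)]
    have h2 := D.toContinuousLinearEquiv.image_closure
      (convexHull ℝ ((polarAt (vectorSpan ℝ P) g P).extremePoints ℝ))
    rw [LinearEquiv.coe_toContinuousLinearEquiv'] at h2
    have h3 := D.toLinearMap.image_convexHull ((polarAt (vectorSpan ℝ P) g P).extremePoints ℝ)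
    rw [LinearEquiv.coe_coe, hDext] at h3
    rw [h2, h3]
  have hpolar : polarAt (vectorSpan ℝ P) g (T '' P) = polarAt (vectorSpan ℝ P) g P := by
    refine D.injective.image_injective ?_
    rw [himage subset_rfl, hDP]
  have hTPL : ∀ y ∈ T '' P, y - g ∈ vectorSpan ℝ P := by
    rintro _ ⟨y, hy, rfl⟩
    simpa only [map_sub, hTg] using hTL _ (hPL y hy)
  have hTP : ∀ y, y - g ∈ vectorSpan ℝ P → (y ∈ T '' P ↔ y ∈ P) := fun y hy => by
    rw [mem_iff_forall_polarAt hP.convex hP.isCompact.isClosed hgP hPL hy,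
      mem_iff_forall_polarAt (hP.convex.linear_image T)
        (hP.isCompact.image T.continuous_of_finiteDimensional).isClosed ⟨g, hgP, hTg⟩ hTPL hy,
      hpolar]
  exact Set.Subset.antisymm (fun y hy => (hTP y (hTPL y hy)).1 hy)
    fun y hy => (hTP y (hPL y hy)).2 hy

end PMF2

/-! ### Full-rank factorizations and the conclusion -/

/-- A matrix of full row rank has a right inverse. -/
theorem Matrix.exists_mul_eq_one_of_rank_eq {r n : ℕ} {M : Matrix (Fin r) (Fin n) ℝ}
    (h : M.rank = r) : ∃ R : Matrix (Fin n) (Fin r) ℝ, M * R = 1 := by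
  rw [← Matrix.mulVec_surjective_iff_exists_right_inverse]
  have h1 : LinearMap.range M.mulVecLin = ⊤ := by
    apply Submodule.eq_top_of_finrank_eq
    rw [Module.finrank_fin_fun]
    exact h
  exact LinearMap.range_eq_top.1 h1

/-- Two full-rank factorizations of a matrix differ by an invertible matrix. -/
theorem Matrix.exists_mul_eq_mul_of_rank_eq {m n r : ℕ} {W W' : Matrix (Fin m) (Fin r) ℝ}
    {H H' : Matrix (Fin r) (Fin n) ℝ} (h : W * H = W' * H') (hr : r = (W * H).rank) :
    (∃ Q : Matrix (Fin m) (Fin r) ℝ, Wᵀ * Q = 1) ∧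
      (∃ R : Matrix (Fin n) (Fin r) ℝ, H * R = 1) ∧
      ∃ A G : Matrix (Fin r) (Fin r) ℝ, A * G = 1 ∧ H' = A * H ∧ W' = W * G := by
  have hrank : ∀ {U : Matrix (Fin m) (Fin r) ℝ} {Z : Matrix (Fin r) (Fin n) ℝ},
      r = (U * Z).rank → U.rank = r ∧ Z.rank = r := fun {U Z} hUZ => by
    have h1 := Matrix.rank_mul_le U Z
    have h2 := U.rank_le_width
    have h3 := Z.rank_le_height
    rw [← hUZ, le_min_iff] at h1
    exact ⟨le_antisymm h2 h1.1, le_antisymm h3 h1.2⟩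
  obtain ⟨hW, hH⟩ := hrank hr
  obtain ⟨hW', hH'⟩ := hrank (h ▸ hr)
  obtain ⟨R, hR⟩ := Matrix.exists_mul_eq_one_of_rank_eq hH
  obtain ⟨R', hR'⟩ := Matrix.exists_mul_eq_one_of_rank_eq hH'
  obtain ⟨Q, hQ⟩ := Matrix.exists_mul_eq_one_of_rank_eq (M := Wᵀ)
    (by rw [Matrix.rank_transpose, hW])
  have hQ' : Qᵀ * W = 1 := by
    rw [← Matrix.transpose_transpose W, ← Matrix.transpose_mul, hQ, Matrix.transpose_one]
  have hHG : H = (Qᵀ * W') * H' := by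
    rw [Matrix.mul_assoc, ← h, ← Matrix.mul_assoc, hQ', Matrix.one_mul]
  have hG : (Qᵀ * W') * (H' * R) = 1 := by
    rw [← Matrix.mul_assoc, ← hHG, hR]
  have hG' := mul_eq_one_comm.1 hG
  refine ⟨⟨Q, hQ⟩, ⟨R, hR⟩, H' * R, Qᵀ * W', hG', ?_, ?_⟩
  · conv_rhs => rw [hHG]
    rw [← Matrix.mul_assoc, hG', Matrix.one_mul]
  · have h4 : W' * H' = W * (Qᵀ * W') * H' := by
      rw [← h, Matrix.mul_assoc W, ← hHG]
    have h5 := congrArg (· * R') h4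
    simpa [Matrix.mul_assoc, hR'] using h5

theorem mainTheorem2 {m n r : ℕ} (X : Matrix (Fin m) (Fin n) ℝ)
    (W : Matrix (Fin m) (Fin r) ℝ) (H : Matrix (Fin r) (Fin n) ℝ)
    (PW PH : Set (EuclideanSpace ℝ (Fin r)))
    (hPMF : PMF2.IsPMF X W H PW PH) (hr : r = X.rank)
    (hW : PMF2.IsSSF Wᵀ PW) (hH : PMF2.IsSSF H PH)
    (hPW : PMF2.IsPSOI (PW.extremePoints ℝ)) (hPH : PMF2.IsPSOI (PH.extremePoints ℝ)) :
    PMF2.IsIdentifiable X W H PW PH := by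
  intro W' H' h'
  rcases Nat.eq_zero_or_pos r with rfl | hpos
  · exact ⟨1, 1, fun i => i.elim0, Subsingleton.elim _ _, Subsingleton.elim _ _⟩
  obtain ⟨⟨Q, hQ⟩, ⟨R, hR⟩, A, G, hAG, hHA, hWG⟩ :=
    Matrix.exists_mul_eq_mul_of_rank_eq (hPMF.eq_mul.symm.trans h'.eq_mul)
      (hr.trans (congrArg Matrix.rank hPMF.eq_mul))
  obtain ⟨hA, hAP⟩ := hH.map_columns hpos hPMF.polytope_right hR A fun j => by
    rw [← hHA]
    exact h'.cols_mem j
  obtain ⟨hG, -⟩ := hW.map_columns hpos hPMF.polytope_left hQ Gᵀ fun i => by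
    rw [← Matrix.transpose_mul, ← hWG]
    exact h'.rows_mem i
  have hdet : |A.det| * |G.det| = 1 := by
    rw [← abs_mul, ← Matrix.det_mul, hAG, Matrix.det_one, abs_one]
  rw [Matrix.det_transpose] at hG
  -- Two nonnegative numbers at most 1 with product 1 are both 1.
  have hA1 : |A.det| = 1 := by nlinarith [abs_nonneg A.det, abs_nonneg G.det]
  have hext : Matrix.toEuclideanLin A '' PH.extremePoints ℝ = PH.extremePoints ℝ := by
    have h0 : LinearMap.det (Matrix.toEuclideanLin A) ≠ 0 := fun h0 => by
      rw [LinearMap.det_toLpLin] at h0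
      simp [h0] at hA1
    refine (image_extremePoints (𝕜 := ℝ) (LinearMap.equivOfDetNeZero _ h0) PH).trans ?_
    exact congrArg (Set.extremePoints ℝ) (hAP hA1)
  obtain ⟨σ, d, hd, hAσ⟩ := hPH A hext
  refine ⟨σ, d, hd, ?_, by rw [hHA, hAσ]⟩
  -- With `A = D Π` this gives `G = Π⁻¹ D⁻¹ = Πᵀ D⁻¹`, the required form of `W'`.
  have hGA : G = A⁻¹ := (Matrix.inv_eq_right_inv hAG).symm
  rw [hWG, hGA, hAσ, Matrix.mul_inv_rev, Matrix.mul_assoc]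
  congr 2
  apply Matrix.inv_eq_left_inv
  rw [Matrix.transpose_permMatrix, ← Matrix.permMatrix_mul]
  simp
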